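/- Let $\Gamma$ be a connected compact metric graph: a finite connected graph without loops or multiple edges, each edge ${\bf e}$ having a length $\ell_{\bf e}\in(0,\infty)$ and being identified with $[0,\ell_{\bf e}]$, running from its initial vertex ${\rm i}_{\bf e}$ to its terminal vertex ${\rm f}_{\bf e}$. A function $u$ on $\Gamma$ is a family $([u]_{\bf e})_{\bf e}$ of functions on $(0,\ell_{\bf e})$; $\int_\Gamma u=\sum_{\bf e}\int_0^{\ell_{\bf e}}[u]_{\bf e}$, $\ell(A)=\int_\Gamma\chi_A$ for measurable $A\subset\Gamma$, and $L^p(\Gamma)$, $BV(\Gamma)$, $W^{1,2}(\Gamma)$ are defined edge by edge, with no condition at the vertices. For ${\bf z}\in W^{1,2}(\Gamma)$ and a vertex ${\bf v}$ of ${\bf e}$ put $[{\bf z}]_{\bf e}({\bf v})=[{\bf z}]_{\bf e}(\ell_{\bf e})$ if ${\bf v}={\rm f}_{\bf e}$ and $[{\bf z}]_{\bf e}({\bf v})=-[{\bf z}]_{\bf e}(0)$ if ${\bf v}={\rm i}_{\bf e}$ (continuous representative), and let $X_K(\Gamma)$ be the set of ${\bf z}\in W^{1,2}(\Gamma)$ with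 $\sum_{{\bf e}\ni{\bf v}}[{\bf z}]_{\bf e}({\bf v})=0$ for every vertex ${\bf v}$. For $u\in BV(\Gamma)$ let $$TV_\Gamma(u)=\sup\Big\{\Big|\int_\Gamma u\,{\bf z}'\Big| : {\bf z}\in X_K(\Gamma),\ \|{\bf z}\|_{L^\infty(\Gamma)}\le 1\Big\}.$$ A measurable set $E\subset\Gamma$ has finite perimeter if $\chi_E\in BV(\Gamma)$, and then ${\rm Per}_\Gamma(E)=TV_\Gamma(\chi_E)$. Let $\mathcal F_\Gamma:L^2(\Gamma)\to[0,\infty]$ be $TV_\Gamma$ on $BV(\Gamma)$ and $+\infty$ elsewhere, let $\partial\mathcal F_\Gamma$ be its subdifferential in $L^2(\Gamma)$, and define the (multivalued) $1$-Laplacian by $-\Delta_1^\Gamma u=\partial\mathcal F_\Gamma(u)$. A pair $(\lambda,u)\in\mathbb R\times BV(\Gamma)$ is a $\Gamma$-eigenpair of $-\Delta_1^\Gamma$ if $\|u\|_{L^1(\Gamma)}=1$ and $\lambda\xi\in\partial\mathcal F_\Gamma(u)$ for some $\xi\in{\rm sign}(u)$, where ${\rm sign}(r)$ is $\{1\}$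 for $r>0$, $\{-1\}$ for $r<0$ and $[-1,1]$ for $r=0$. Let $\Omega\subset\Gamma$ be measurable with $\ell(\Omega)>0$, and put $\lambda_\Omega^\Gamma={\rm Per}_\Gamma(\Omega)/\ell(\Omega)$. If $\big(\lambda_\Omega^\Gamma,\tfrac1{\ell(\Omega)}\chi_\Omega\big)$ is a $\Gamma$-eigenpair of $-\Delta_1^\Gamma$, then $\Omega$ is $\Gamma$-calibrable, that is, $\Omega$ has finite perimeter and $$\frac{{\rm Per}_\Gamma(\Omega)}{\ell(\Omega)}=h_1^\Gamma(\Omega):=\inf\Big\{\frac{{\rm Per}_\Gamma(E)}{\ell(E)} : E\subset\Omega \text{ of finite perimeter},\ \ell(E)>0\Big\}.$$ -/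

import Mathlib

open MeasureTheory Set
open scoped ENNReal ContDiff

noncomputable section

/-! ### Functions of one variable on the interval `(0, L)` -/

/-- Lebesgue measure on the open interval `(0, L)`. -/
def intervalMeasure (L : ℝ) : Measure ℝ := volume.restrict (Ioo 0 L)

/-- Test functions on `(0, L)`: smooth functions with compact support contained in `(0, L)`. -/
def IsTestFunction (L : ℝ) (φ : ℝ → ℝ) : Prop :=
  ContDiff ℝ ∞ φ ∧ HasCompactSupport φ ∧ tsupport φ ⊆ Ioo 0 L

/-- `f ∈ BV(0, L)`: `f ∈ L¹(0, L)` and the distributional derivative of `f` is a finite signed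
measure, written as a difference `μ - ν` of two finite positive measures. -/
def MemBVInterval (L : ℝ) (f : ℝ → ℝ) : Prop :=
  MemLp f 1 (intervalMeasure L) ∧
    ∃ μ ν : Measure ℝ, IsFiniteMeasure μ ∧ IsFiniteMeasure ν ∧
      ∀ φ : ℝ → ℝ, IsTestFunction L φ →
        ∫ t, f t * deriv φ t ∂(intervalMeasure L) = -((∫ t, φ t ∂μ) - ∫ t, φ t ∂ν)

/-- `g` is the weak derivative of `f` on `(0, L)`. -/
def IsWeakDeriv (L : ℝ) (f g : ℝ → ℝ) : Prop :=
  ∀ φ : ℝ → ℝ, IsTestFunction L φ →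
    ∫ t, f t * deriv φ t ∂(intervalMeasure L) = -∫ t, g t * φ t ∂(intervalMeasure L)

/-- `f` is (the continuous representative on `[0, L]` of) an element of `W^{1,2}(0, L)`, with weak
derivative `g`. Every element of `W^{1,2}(0, L)` has exactly one such representative; its values
at `0` and `L` are the boundary values of the element. -/
def IsSobolevRep (L : ℝ) (f g : ℝ → ℝ) : Prop :=
  ContinuousOn f (Icc 0 L) ∧ MemLp f 2 (intervalMeasure L) ∧ MemLp g 2 (intervalMeasure L) ∧
    IsWeakDeriv L f g

/-- The multivalued sign: `{1}` on positive numbers, `{-1}` on negative ones, `[-1, 1]` at `0`. -/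
def signSet (r : ℝ) : Set ℝ :=
  if 0 < r then {1} else if r < 0 then {-1} else Icc (-1) 1

/-! ### Metric graphs -/

/-- A connected metric graph on the vertex set `V` without loops or multiple edges, all of whose
edges have finite length. It is compact when `V` is finite. Each edge `e` is identified with an
ordered pair `(initial e, terminal e)`. -/
structure MetricGraph (V : Type*) where
  /-- the underlying combinatorial graph -/
  graph : SimpleGraph V
  connected : graph.Connected
  /-- the initial vertex of an edge -/
  initial : graph.edgeSet → V
  /-- the terminal vertex of an edge -/
  terminal : graph.edgeSet → V
  ends_eq : ∀ e : graph.edgeSet, s(initial e, terminal e) = (e : Sym2 V)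
  /-- the length of an edge -/
  edgeLength : graph.edgeSet → ℝ
  edgeLength_pos : ∀ e, 0 < edgeLength e

namespace MetricGraph

variable {V : Type*}

/-- The edges of the metric graph. -/
abbrev Edge (Γ : MetricGraph V) : Type _ := Γ.graph.edgeSet

instance instFintypeEdge [Finite V] (Γ : MetricGraph V) : Fintype Γ.Edge := Fintype.ofFinite _

/-- The points of the metric graph: its vertices and the interior points of its edges, an interior
point of `e` being given by its coordinate in `(0, ℓ_e)`. -/
inductive Point (Γ : MetricGraph V) : Type _
  | vertex (v : V) : Point Γ
  | interior (e : Γ.Edge) (t : Ioo (0 : ℝ) (Γ.edgeLength e)) : Point Γ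

/-- The point of the (closed) edge `e` with coordinate `t ∈ [0, ℓ_e]`: this is `c_e⁻¹ (t)`. -/
def pointAt (Γ : MetricGraph V) (e : Γ.Edge) (t : Icc (0 : ℝ) (Γ.edgeLength e)) : Γ.Point :=
  if h0 : (t : ℝ) = 0 then Point.vertex (Γ.initial e)
  else if h1 : (t : ℝ) = Γ.edgeLength e then Point.vertex (Γ.terminal e)
  else Point.interior e ⟨t, lt_of_le_of_ne t.2.1 (Ne.symm h0), lt_of_le_of_ne t.2.2 h1⟩

/-- The set `c_e (A ∩ e) ⊆ [0, ℓ_e]` of coordinates of the points of `A` on the edge `e`. -/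
def coords (Γ : MetricGraph V) (A : Set Γ.Point) (e : Γ.Edge) : Set ℝ :=
  {t | ∃ ht : t ∈ Icc (0 : ℝ) (Γ.edgeLength e), Γ.pointAt e ⟨t, ht⟩ ∈ A}

/-- Lebesgue measurability of a subset of the metric graph. -/
def IsMeasurable (Γ : MetricGraph V) (A : Set Γ.Point) : Prop :=
  ∀ e, NullMeasurableSet (Γ.coords A e) volume

/-- A function on the metric graph is a collection of functions `[u]_e` of the edge coordinate,
of which only the values on `(0, ℓ_e)` are relevant. -/
abbrev Fn (Γ : MetricGraph V) : Type _ := Γ.Edge → ℝ → ℝ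

/-- Lebesgue measure on the edge `e`. -/
abbrev edgeMeasure (Γ : MetricGraph V) (e : Γ.Edge) : Measure ℝ :=
  intervalMeasure (Γ.edgeLength e)

/-- The characteristic function of a set. -/
def char (Γ : MetricGraph V) (A : Set Γ.Point) : Γ.Fn :=
  fun e => (Γ.coords A e).indicator 1

/-- `u ∈ L²(Γ)`. -/
def MemL2 (Γ : MetricGraph V) (u : Γ.Fn) : Prop := ∀ e, MemLp (u e) 2 (Γ.edgeMeasure e)

/-- `u ∈ BV(Γ)`. -/
def MemBV (Γ : MetricGraph V) (u : Γ.Fn) : Prop := ∀ e, MemBVInterval (Γ.edgeLength e) (u e)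

open Classical in
/-- The boundary value `[z]_e(v)` of `z` at an end `v` of `e`: `z(ℓ_e)` at the terminal vertex
and `-z(0)` at the initial vertex. -/
def flux (Γ : MetricGraph V) (z : Γ.Fn) (e : Γ.Edge) (v : V) : ℝ :=
  if v = Γ.terminal e then z e (Γ.edgeLength e) else -z e 0

section Compact

variable [Finite V]

/-- The length of a set. -/
def length (Γ : MetricGraph V) (A : Set Γ.Point) : ℝ≥0∞ := ∑ e : Γ.Edge, volume (Γ.coords A e)

/-- The integral over the metric graph. -/
def integral (Γ : MetricGraph V) (u : Γ.Fn) : ℝ := ∑ e : Γ.Edge, ∫ t, u e t ∂(Γ.edgeMeasure e)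

open Classical in
/-- `z` is (the continuous representative, edge by edge, of) an element of `X_K(Γ)` with weak
derivative `dz`: it belongs to `W^{1,2}(Γ)` and satisfies the Kirchhoff condition
`∑_{e ∋ v} [z]_e(v) = 0` at every vertex `v`. -/
def MemXK (Γ : MetricGraph V) (z dz : Γ.Fn) : Prop :=
  (∀ e, IsSobolevRep (Γ.edgeLength e) (z e) (dz e)) ∧
    ∀ v : V, ∑ e : Γ.Edge, (if v ∈ (e : Sym2 V) then Γ.flux z e v else 0) = 0

/-- The total variation
`TV_Γ(u) = sup { |∫_Γ u z'| : z ∈ X_K(Γ), ‖z‖_∞ ≤ 1 }`, for `u ∈ BV(Γ)`. -/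
def totalVariation (Γ : MetricGraph V) (u : Γ.Fn) : ℝ≥0∞ :=
  ⨆ (z : Γ.Fn) (dz : Γ.Fn) (_ : Γ.MemXK z dz) (_ : ∀ e, eLpNorm (z e) ∞ (Γ.edgeMeasure e) ≤ 1),
    ENNReal.ofReal |Γ.integral fun e t => u e t * dz e t|

/-- Sets of finite perimeter. -/
def HasFinitePerimeter (Γ : MetricGraph V) (A : Set Γ.Point) : Prop :=
  Γ.IsMeasurable A ∧ Γ.MemBV (Γ.char A)

/-- The `Γ`-perimeter, for sets of finite perimeter. -/
def perimeter (Γ : MetricGraph V) (A : Set Γ.Point) : ℝ≥0∞ := Γ.totalVariation (Γ.char A)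

/-! ### The Cheeger problem -/

/-- The `Γ`-Cheeger constant
`h₁(Ω) = inf { Per_Γ(E) / ℓ(E) : E ⊆ Ω of finite perimeter, ℓ(E) > 0 }`. -/
def cheegerConstant (Γ : MetricGraph V) (Ω : Set Γ.Point) : ℝ≥0∞ :=
  ⨅ (E : Set Γ.Point) (_ : E ⊆ Ω) (_ : Γ.HasFinitePerimeter E) (_ : 0 < Γ.length E),
    Γ.perimeter E / Γ.length E

/-- `E` is a `Γ`-Cheeger set of `Ω`: it is admissible for the infimum and attains it. -/
def IsCheegerSet (Γ : MetricGraph V) (Ω E : Set Γ.Point) : Prop :=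
  E ⊆ Ω ∧ Γ.HasFinitePerimeter E ∧ 0 < Γ.length E ∧
    Γ.cheegerConstant Ω = Γ.perimeter E / Γ.length E

/-- `Ω` is `Γ`-calibrable: it is a `Γ`-Cheeger set of itself. -/
def IsCalibrable (Γ : MetricGraph V) (Ω : Set Γ.Point) : Prop := Γ.IsCheegerSet Ω Ω

/-- `λ_Ω = Per_Γ(Ω) / ℓ(Ω)`. -/
def cheegerRatio (Γ : MetricGraph V) (Ω : Set Γ.Point) : ℝ :=
  (Γ.perimeter Ω).toReal / (Γ.length Ω).toReal

/-! ### The `1`-Laplacian and its eigenpairs -/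

open Classical in
/-- The energy functional on `L²(Γ)`: the total variation on `BV(Γ)` and `+∞` elsewhere. -/
def energy (Γ : MetricGraph V) (u : Γ.Fn) : ℝ≥0∞ :=
  if Γ.MemBV u then Γ.totalVariation u else ∞

/-- The subdifferential in `L²(Γ)` of the energy functional at `u`. -/
def subdifferential (Γ : MetricGraph V) (u : Γ.Fn) : Set Γ.Fn :=
  {v | Γ.MemL2 u ∧ Γ.MemL2 v ∧ ∀ w : Γ.Fn, Γ.MemL2 w →
    (Γ.energy u : EReal) + ((Γ.integral fun e t => v e t * (w e t - u e t) : ℝ) : EReal)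
      ≤ (Γ.energy w : EReal)}

/-- The `1`-Laplacian, a multivalued operator on `L²(Γ)`:
`(u, v) ∈ Δ₁` if and only if `-v ∈ ∂F(u)`. -/
def oneLaplacian (Γ : MetricGraph V) : Set (Γ.Fn × Γ.Fn) :=
  {p | -p.2 ∈ Γ.subdifferential p.1}

/-- `(l, u)` is a `Γ`-eigenpair of `-Δ₁`: `u ∈ BV(Γ)`, `‖u‖_{L¹(Γ)} = 1`, and there is
`ξ ∈ sign(u)` with `l ξ ∈ -Δ₁ u`. -/
def IsEigenpair (Γ : MetricGraph V) (l : ℝ) (u : Γ.Fn) : Prop :=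
  Γ.MemBV u ∧ Γ.integral (fun e t => |u e t|) = 1 ∧
    ∃ ξ : Γ.Fn, (∀ e, ∀ᵐ t ∂(Γ.edgeMeasure e), ξ e t ∈ signSet (u e t)) ∧
      (u, -(l • ξ)) ∈ Γ.oneLaplacian

end Compact

end MetricGraph

end

/-! Put `c = 1/ℓ(Ω)` and `λ = Per(Ω)/ℓ(Ω)`. The subgradient inequality at `c χ_Ω` is tested against
`χ_E` for `E ⊆ Ω`. Since `ξ = 1` a.e. on `Ω` and both functions vanish off `Ω`, the pairing equals
`λ(ℓ(E) - 1)` (`integral_smul_sign_mul_char_sub`). By homogeneity (`totalVariation_const_smul`) the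
energy of `c χ_Ω` is `c Per(Ω) = λ`. The inequality thus reads `λ ℓ(E) ≤ Per(E)`: no competitor has
a smaller ratio than `Ω`. -/

theorem MemBVInterval.const_smul {L : ℝ} {f : ℝ → ℝ} (hf : MemBVInterval L f) {c : ℝ}
    (hc : 0 ≤ c) : MemBVInterval L (c • f) := by
  obtain ⟨h1, μ, ν, hμ, hν, h⟩ := hf
  -- A nonnegative factor keeps both parts of the derivative positive, so `μ` and `ν` need not be
  -- exchanged.
  refine ⟨h1.const_smul c, ENNReal.ofReal c • μ, ENNReal.ofReal c • ν,
    ⟨by simpa using ENNReal.mul_lt_top ENNReal.ofReal_lt_top (measure_lt_top μ univ)⟩,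
    ⟨by simpa using ENNReal.mul_lt_top ENNReal.ofReal_lt_top (measure_lt_top ν univ)⟩, ?_⟩
  intro φ hφ
  simp only [Pi.smul_apply, smul_eq_mul, mul_assoc, integral_const_mul, integral_smul_measure,
    ENNReal.toReal_ofReal hc, h φ hφ]
  ring

theorem MemBVInterval.zero (L : ℝ) : MemBVInterval L 0 :=
  ⟨MemLp.zero, 0, 0, inferInstance, inferInstance, by simp⟩

theorem signSet_of_pos {r : ℝ} (hr : 0 < r) : signSet r = {1} := by simp [signSet, hr]

instance (L : ℝ) : IsFiniteMeasure (intervalMeasure L) :=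
  ⟨by simp [intervalMeasure]⟩

namespace MetricGraph

variable {V : Type*} {Γ : MetricGraph V}

theorem coords_mono {A B : Set Γ.Point} (h : A ⊆ B) (e : Γ.Edge) :
    Γ.coords A e ⊆ Γ.coords B e :=
  fun _ ⟨ht, hA⟩ => ⟨ht, h hA⟩

theorem coords_subset_Icc (A : Set Γ.Point) (e : Γ.Edge) :
    Γ.coords A e ⊆ Icc 0 (Γ.edgeLength e) :=
  fun _ ⟨ht, _⟩ => ht

theorem char_empty : Γ.char ∅ = 0 := by
  have h (e : Γ.Edge) : Γ.coords ∅ e = ∅ := by simp [coords]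
  funext e
  simp only [char, h, indicator_empty]
  rfl

theorem isMeasurable_empty : Γ.IsMeasurable ∅ := fun e => by
  simp [coords]

theorem IsMeasurable.nullMeasurableSet {A : Set Γ.Point} (hA : Γ.IsMeasurable A) (e : Γ.Edge) :
    NullMeasurableSet (Γ.coords A e) (Γ.edgeMeasure e) :=
  (hA e).mono_ac Measure.absolutelyContinuous_restrict

theorem volume_coords_ne_top (A : Set Γ.Point) (e : Γ.Edge) : volume (Γ.coords A e) ≠ ⊤ :=
  ((measure_mono (Γ.coords_subset_Icc A e)).trans_lt (by simp)).ne

/-- `coords` may contain the endpoints of the edge, which `edgeMeasure` omits; they form a null set.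
-/
theorem edgeMeasure_coords (A : Set Γ.Point) (e : Γ.Edge) :
    Γ.edgeMeasure e (Γ.coords A e) = volume (Γ.coords A e) := by
  rw [edgeMeasure, intervalMeasure, Measure.restrict_congr_set Ioo_ae_eq_Icc,
    Measure.restrict_eq_self _ (Γ.coords_subset_Icc A e)]

theorem integrable_char {A : Set Γ.Point} (hA : Γ.IsMeasurable A) (e : Γ.Edge) :
    Integrable (Γ.char A e) (Γ.edgeMeasure e) :=
  (integrable_const (1 : ℝ)).indicator₀ (hA.nullMeasurableSet e)

theorem integral_char_edge {A : Set Γ.Point} (hA : Γ.IsMeasurable A) (e : Γ.Edge) :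
    ∫ t, Γ.char A e t ∂(Γ.edgeMeasure e) = (volume (Γ.coords A e)).toReal := by
  have h := integral_indicator₀ (f := fun _ => (1 : ℝ)) (hA.nullMeasurableSet e)
  rw [setIntegral_const, smul_eq_mul, mul_one, measureReal_def, edgeMeasure_coords] at h
  exact h

theorem memL2_char {A : Set Γ.Point} (hA : Γ.IsMeasurable A) : Γ.MemL2 (Γ.char A) := fun e =>
  MemLp.of_bound (integrable_char hA e).aestronglyMeasurable 1 <| ae_of_all _ fun t => by
    by_cases ht : t ∈ Γ.coords A e <;> simp [char, ht]

theorem MemBV.const_smul {u : Γ.Fn} (hu : Γ.MemBV u) {c : ℝ} (hc : 0 ≤ c) : Γ.MemBV (c • u) :=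
  fun e => (hu e).const_smul hc

variable [Finite V]

theorem length_ne_top (A : Set Γ.Point) : Γ.length A ≠ ⊤ :=
  ENNReal.sum_ne_top.2 fun e _ => volume_coords_ne_top A e

theorem integral_char {A : Set Γ.Point} (hA : Γ.IsMeasurable A) :
    Γ.integral (Γ.char A) = (Γ.length A).toReal := by
  rw [length, ENNReal.toReal_sum fun e _ => volume_coords_ne_top A e]
  exact Finset.sum_congr rfl fun e _ => integral_char_edge hA e

theorem totalVariation_zero : Γ.totalVariation 0 = 0 := by
  simp [totalVariation, integral]

theorem totalVariation_const_smul (u : Γ.Fn) {c : ℝ} (hc : 0 ≤ c) :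
    Γ.totalVariation (c • u) = ENNReal.ofReal c * Γ.totalVariation u := by
  have h (dz : Γ.Fn) : ENNReal.ofReal |Γ.integral fun e t => (c • u) e t * dz e t| =
      ENNReal.ofReal c * ENNReal.ofReal |Γ.integral fun e t => u e t * dz e t| := by
    rw [← ENNReal.ofReal_mul hc]
    simp only [integral, Pi.smul_apply, smul_eq_mul, mul_assoc, integral_const_mul,
      ← Finset.mul_sum, abs_mul, abs_of_nonneg hc]
  simp only [totalVariation, h, ENNReal.mul_iSup]

theorem energy_of_memBV {u : Γ.Fn} (hu : Γ.MemBV u) : Γ.energy u = Γ.totalVariation u :=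
  if_pos hu

/-- The pairing of a multiple of a sign of `c χ_Ω` with `χ_E - c χ_Ω`, for `E ⊆ Ω`. -/
theorem integral_smul_sign_mul_char_sub {Ω E : Set Γ.Point} (hΩ : Γ.IsMeasurable Ω)
    (hE : Γ.IsMeasurable E) (hEΩ : E ⊆ Ω) {c : ℝ} (hc : 0 < c) (l : ℝ) {ξ : Γ.Fn}
    (hξ : ∀ e, ∀ᵐ t ∂(Γ.edgeMeasure e), ξ e t ∈ signSet ((c • Γ.char Ω) e t)) :
    (Γ.integral fun e t => (l • ξ) e t * (Γ.char E e t - (c • Γ.char Ω) e t)) =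
      l * ((Γ.length E).toReal - c * (Γ.length Ω).toReal) := by
  rw [← integral_char hE, ← integral_char hΩ]
  simp only [integral, Finset.mul_sum, ← Finset.sum_sub_distrib]
  refine Finset.sum_congr rfl fun e _ => ?_
  rw [← integral_const_mul, ← integral_sub (integrable_char hE e)
    ((integrable_char hΩ e).const_mul c), ← integral_const_mul]
  refine integral_congr_ae ?_
  filter_upwards [hξ e] with t ht
  -- On `Ω` the sign is forced to be `1`; off `Ω` it is undetermined, but there its cofactor `χ_E -
  -- c χ_Ω` is zero.
  by_cases hm : t ∈ Γ.coords Ω e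
  · have h1 : Γ.char Ω e t = 1 := by simp [char, hm]
    simp only [Pi.smul_apply, smul_eq_mul, h1, mul_one, signSet_of_pos hc,
      mem_singleton_iff] at ht ⊢
    rw [ht, mul_one]
  · have hmE : t ∉ Γ.coords E e := fun h => hm (coords_mono hEΩ e h)
    simp [char, hm, hmE]

end MetricGraph

open MetricGraph in
theorem mainTheorem11 {V : Type*} [Finite V] (Γ : MetricGraph V) (Ω : Set Γ.Point)
    (hΩ : Γ.IsMeasurable Ω) (hpos : 0 < Γ.length Ω)
    (hpair : Γ.IsEigenpair (Γ.cheegerRatio Ω) ((Γ.length Ω).toReal⁻¹ • Γ.char Ω)) :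
    Γ.IsCalibrable Ω := by
  obtain ⟨hBV, -, ξ, hξ, hsub⟩ := hpair
  have hΩtop := length_ne_top Ω
  have hℓ : 0 < (Γ.length Ω).toReal := ENNReal.toReal_pos hpos.ne' hΩtop
  have hcpos := inv_pos.2 hℓ
  have hBVΩ : Γ.MemBV (Γ.char Ω) := by
    have h := hBV.const_smul hℓ.le
    rwa [smul_smul, mul_inv_cancel₀ hℓ.ne', one_smul] at h
  simp only [oneLaplacian, subdifferential, mem_ofPred_eq, neg_neg] at hsub
  have key {E : Set Γ.Point} (hE : Γ.IsMeasurable E) (hEΩ : E ⊆ Ω) :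
      ((ENNReal.ofReal (Γ.length Ω).toReal⁻¹ * Γ.perimeter Ω : ℝ≥0∞) : EReal) +
        ((Γ.cheegerRatio Ω * ((Γ.length E).toReal - 1) : ℝ) : EReal) ≤
          (Γ.energy (Γ.char E) : EReal) := by
    have h := hsub.2.2 _ (memL2_char hE)
    rwa [energy_of_memBV hBV, totalVariation_const_smul _ hcpos.le,
      integral_smul_sign_mul_char_sub hΩ hE hEΩ hcpos _ hξ, inv_mul_cancel₀ hℓ.ne'] at h
  -- `cheegerRatio` goes through `toReal`, which would turn an infinite perimeter into `0`. Testing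
  -- with `E = ∅`, whose energy is `0`, excludes this: the left side would be `⊤`.
  have hPer : Γ.perimeter Ω ≠ ⊤ := by
    intro htop
    have h := key isMeasurable_empty (empty_subset _)
    rw [char_empty, energy_of_memBV (u := 0) fun e => MemBVInterval.zero _, totalVariation_zero, htop,
      ENNReal.mul_top (by simpa using hcpos), EReal.coe_ennreal_top, EReal.top_add_coe] at h
    simp at h
  have hEnergy : ENNReal.ofReal (Γ.length Ω).toReal⁻¹ * Γ.perimeter Ω =
      ENNReal.ofReal (Γ.cheegerRatio Ω) := by
    rw [cheegerRatio, div_eq_inv_mul, ENNReal.ofReal_mul hcpos.le, ENNReal.ofReal_toReal hPer]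
  have hRatio : ENNReal.ofReal (Γ.cheegerRatio Ω) = Γ.perimeter Ω / Γ.length Ω := by
    rw [cheegerRatio, ← ENNReal.toReal_div,
      ENNReal.ofReal_toReal (ENNReal.div_ne_top hPer hpos.ne')]
  have hl : 0 ≤ Γ.cheegerRatio Ω := div_nonneg ENNReal.toReal_nonneg ENNReal.toReal_nonneg
  refine ⟨Subset.rfl, ⟨hΩ, hBVΩ⟩, hpos, le_antisymm ?_ ?_⟩
  · exact iInf₂_le_of_le Ω Subset.rfl (iInf₂_le_of_le ⟨hΩ, hBVΩ⟩ hpos le_rfl)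
  · refine le_iInf₂ fun E hEΩ => le_iInf₂ fun hE hEpos => ?_
    rw [ENNReal.le_div_iff_mul_le (.inl hEpos.ne') (.inl (length_ne_top E)), ← hRatio]
    have h := key hE.1 hEΩ
    -- The energy `λ` of `c χ_Ω` cancels the `-λ` of the pairing, leaving `λ ℓ(E) ≤ Per(E)`.
    rw [hEnergy, energy_of_memBV hE.2, EReal.coe_ennreal_ofReal, max_eq_left hl,
      ← EReal.coe_add, mul_sub, mul_one, add_sub_cancel] at h
    rw [← ENNReal.ofReal_toReal (length_ne_top E), ← ENNReal.ofReal_mul hl,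
      ← EReal.coe_ennreal_le_coe_ennreal_iff, EReal.coe_ennreal_ofReal,
      max_eq_left (mul_nonneg hl ENNReal.toReal_nonneg)]
    exact h
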